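/- **Conventions.** Let $\mathcal K$ be an $\infty$-category (quasicategory); $\mathcal K(A,B)$ is the Kan complex of morphisms from $A$ to $B$, $\simeq$ is equivalence (homotopy) of morphisms, and $g.f$ is any composite "first $f$, then $g$" (well defined up to $\simeq$). An $\omega$-diagram $K_0\xrightarrow{f_0}K_1\xrightarrow{f_1}\cdots$ in an $\infty$-category is a sequence of objects and morphisms. A cocone $(T,\{\tau_i\})$ under it consists of morphisms $\tau_i:K_i\to T$ with $\tau_{i+1}.f_i\simeq\tau_i$ for all $i\in\omega$; a cocone $(K,\{\delta_i\})$ is a *colimit* if for every cocone $(T,\{\tau_i\})$ there is a morphism $h:K\to T$, unique up to equivalence, with $h.\delta_i\simeq\tau_i$ for all $i$. Cones and *limits* of $\omega^{op}$-diagrams $K_0\leftarrow K_1\leftarrow\cdots$ are defined dually. A *homotopy order* on $\mathcal K(A,B)$ is a transitive relation $\precsim$ on its vertices such that $f\simeq g$ implies $f\precsim g$, and such that $f\precsim g$ and $g\precsim f$ imply $f\simeq g$ (Cantor–Schröder–Bernstein property). It is *complete* if every $\omega$-chain $f_0\precsim f_1\precsim\cdots$ has a supremum $\bigcurlyvee_i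 f_i$ (a least upper bound for $\precsim$, unique up to $\simeq$). A *$(0,\infty)$-category* is an $\infty$-category $\mathcal K$ with a complete homotopy order with a least element $0_{A,B}$ on each $\mathcal K(A,B)$, such that composition is continuous ($\left(\bigcurlyvee_i q_i\right).\left(\bigcurlyvee_i p_i\right)\simeq\bigcurlyvee_i (q_i.p_i)$ for all $\omega$-chains $(p_i)$ in $\mathcal K(A,B)$ and $(q_i)$ in $\mathcal K(B,C)$, the right-hand supremum existing) and $0_{B,C}.F\simeq 0_{A,C}$ for every $F:A\to B$. An *h-projection pair* $(f^+,f^-)$ from $A$ to $B$ consists of $f^+:A\to B$ and $f^-:B\to A$ such that $f^-.f^+\simeq I_A$ and $f^+.f^-\precsim I_B$. The $\infty$-category $\mathcal K^{HPrj}$ has as $n$-simplices the pairs $(\sigma^+,\sigma^-)$ of an $n$-simplex of $\mathcal K$ and an $n$-simplex of $\mathcal K^{op}$ with the same vertices such that every edge $(f^+,f^-)$ of the pair is an h-projection pair; so its objects are those of $\mathcal K$ and its morphisms are the h-projection pairs, composed by $(g^+,g^-).(f^+,f^-)\simeq(g^+.f^+,\,f^-.g^-)$. **Theorem 2.2.**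 Let $\mathcal K$ be a $(0,\infty)$-category and let $(\{K_i\}_{i\in\omega},\{f_i\}_{i\in\omega})$, $f_i=(f_i^+,f_i^-)$, be an $\omega$-diagram in $\mathcal K^{HPrj}$. If $(K,\{\gamma_i\}_{i\in\omega})$ is a limit of the $\omega^{op}$-diagram $(\{K_i\}_{i\in\omega},\{f_i^-\}_{i\in\omega})$ in $\mathcal K$, then every $\gamma_i$ is the right member of an h-projection pair $(\delta_i,\gamma_i)$ from $K_i$ to $K$, and for any choice of such $\delta_i$, $(K,\{(\delta_i,\gamma_i)\}_{i\in\omega})$ is a colimit of $(\{K_i\}_{i\in\omega},\{f_i\}_{i\in\omega})$ in $\mathcal K^{HPrj}$. -/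

import Mathlib

open CategoryTheory Simplicial MonoidalCategory

universe u

namespace HDom

/-! Objects of an `∞`-category are the vertices of a quasicategory `X`, morphisms are its edges.
The edges `A ⟶ B` are the vertices of the Kan complex `X(A,B)`; a `2`-simplex
`Edge.CompStruct f g h` says that `h` is a composite "first `f`, then `g`". -/

/-- Equivalence `f ≃ g` of two parallel edges: they are joined by a path of the (pinched) Kan
complex of morphisms, i.e. there is a `2`-simplex with faces `f`, `id`, `g`. -/
def Homotopic {X : SSet.{u}} {A B : X _⦋0⦌} (f g : SSet.Edge A B) : Prop :=
  Nonempty (SSet.Edge.CompStruct f (SSet.Edge.id B) g)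

/-- `h ≃ g.f` (first `f`, then `g`). -/
def IsComp {X : SSet.{u}} {A B C : X _⦋0⦌} (f : SSet.Edge A B) (g : SSet.Edge B C)
    (h : SSet.Edge A C) : Prop :=
  Nonempty (SSet.Edge.CompStruct f g h)

/-! ### `ω`-diagrams, limits and colimits

Cones commute up to equivalence, and the mediating edge is
required to exist and to be unique up to equivalence. -/

/-- An `ω`-diagram `K₀ ⟶ K₁ ⟶ K₂ ⟶ ⋯`. -/
structure OmegaDiagram (X : SSet.{u}) where
  obj : ℕ → X _⦋0⦌
  map : ∀ i, SSet.Edge (obj i) (obj (i + 1))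

/-- An `ω`ᵒᵖ-diagram `K₀ ⟵ K₁ ⟵ K₂ ⟵ ⋯`. -/
structure OmegaOpDiagram (X : SSet.{u}) where
  obj : ℕ → X _⦋0⦌
  map : ∀ i, SSet.Edge (obj (i + 1)) (obj i)

/-- `(T, τ)` is a cocone under the `ω`-diagram `D`. -/
def OmegaDiagram.IsCocone {X : SSet.{u}} (D : OmegaDiagram X) (T : X _⦋0⦌)
    (τ : ∀ i, SSet.Edge (D.obj i) T) : Prop :=
  ∀ i, IsComp (D.map i) (τ (i + 1)) (τ i)

/-- `(K, δ)` is a colimit of the `ω`-diagram `D`. -/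
structure OmegaDiagram.IsColimit {X : SSet.{u}} (D : OmegaDiagram X) (K : X _⦋0⦌)
    (δ : ∀ i, SSet.Edge (D.obj i) K) : Prop where
  cocone : D.IsCocone K δ
  exists_mediating : ∀ (T : X _⦋0⦌) (τ : ∀ i, SSet.Edge (D.obj i) T), D.IsCocone T τ →
    ∃ h : SSet.Edge K T, ∀ i, IsComp (δ i) h (τ i)
  unique_mediating : ∀ (T : X _⦋0⦌) (τ : ∀ i, SSet.Edge (D.obj i) T), D.IsCocone T τ →
    ∀ h h' : SSet.Edge K T, (∀ i, IsComp (δ i) h (τ i)) → (∀ i, IsComp (δ i) h' (τ i)) →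
      Homotopic h h'

/-- `(T, τ)` is a cone over the `ω`ᵒᵖ-diagram `D`. -/
def OmegaOpDiagram.IsCone {X : SSet.{u}} (D : OmegaOpDiagram X) (T : X _⦋0⦌)
    (τ : ∀ i, SSet.Edge T (D.obj i)) : Prop :=
  ∀ i, IsComp (τ (i + 1)) (D.map i) (τ i)

/-- `(K, γ)` is a limit of the `ω`ᵒᵖ-diagram `D`. -/
structure OmegaOpDiagram.IsLimit {X : SSet.{u}} (D : OmegaOpDiagram X) (K : X _⦋0⦌)
    (γ : ∀ i, SSet.Edge K (D.obj i)) : Prop where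
  cone : D.IsCone K γ
  exists_mediating : ∀ (T : X _⦋0⦌) (τ : ∀ i, SSet.Edge T (D.obj i)), D.IsCone T τ →
    ∃ h : SSet.Edge T K, ∀ i, IsComp h (γ i) (τ i)
  unique_mediating : ∀ (T : X _⦋0⦌) (τ : ∀ i, SSet.Edge T (D.obj i)), D.IsCone T τ →
    ∀ h h' : SSet.Edge T K, (∀ i, IsComp h (γ i) (τ i)) → (∀ i, IsComp h' (γ i) (τ i)) →
      Homotopic h h'

/-! ### Homotopy partial orders -/

/-- A homotopy partial order on `V`, whose elements are considered up to the equivalence `eqv`: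
`le x y` (written `x ≾ y`) means that there is an embedding of `x` into `y`.  Equivalences are
embeddings, embeddings compose, and the Cantor-Schroeder-Bernstein property holds. -/
structure HPO (V : Type u) (eqv : V → V → Prop) where
  le : V → V → Prop
  le_of_eqv : ∀ {x y}, eqv x y → le x y
  le_trans : ∀ {x y z}, le x y → le y z → le x z
  csb : ∀ {x y}, le x y → le y x → eqv x y

/-- `s` is the supremum (under equivalence) of the sequence `p` in the homotopy order. -/
structure HPO.IsSup {V : Type u} {eqv : V → V → Prop} (P : HPO V eqv) (p : ℕ → V) (s : V) :
    Prop where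
  le_sup : ∀ i, P.le (p i) s
  sup_le : ∀ t, (∀ i, P.le (p i) t) → P.le s t

/-- A complete homotopy partial order: every `ω`-chain `p₀ ≾ p₁ ≾ p₂ ≾ ⋯` has a supremum. -/
structure CHPO (V : Type u) (eqv : V → V → Prop) extends HPO V eqv where
  exists_sup : ∀ p : ℕ → V, (∀ i, le (p i) (p (i + 1))) → ∃ s, toHPO.IsSup p s

/-- A `(0,∞)`-category: an `∞`-category all of whose Kan complexes `K(A,B)` of morphisms are
c.h.p.o.s with a least element `0_{A,B}`, such that composition is continuous with respect to
the homotopy order and `0_{B,C}.F ≃ 0_{A,C}`. -/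
class ZeroInftyCategory (K : SSet.{u}) extends SSet.Quasicategory K where
  chpo : ∀ A B : K _⦋0⦌, CHPO (SSet.Edge A B) Homotopic
  zero : ∀ A B : K _⦋0⦌, SSet.Edge A B
  zero_le : ∀ {A B : K _⦋0⦌} (f : SSet.Edge A B), (chpo A B).le (zero A B) f
  comp_continuous : ∀ {A B C : K _⦋0⦌} (p : ℕ → SSet.Edge A B) (q : ℕ → SSet.Edge B C)
    (r : ℕ → SSet.Edge A C) (s : SSet.Edge A B) (t : SSet.Edge B C) (v : SSet.Edge A C),
    (∀ i, (chpo A B).le (p i) (p (i + 1))) → (∀ i, (chpo B C).le (q i) (q (i + 1))) →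
    (∀ i, IsComp (p i) (q i) (r i)) → IsComp s t v →
    (chpo A B).toHPO.IsSup p s → (chpo B C).toHPO.IsSup q t → (chpo A C).toHPO.IsSup r v
  zero_comp : ∀ {A B C : K _⦋0⦌} (F : SSet.Edge A B), IsComp F (zero B C) (zero A C)

/-- The homotopy order `f ≾ g` on morphisms of a `(0,∞)`-category. -/
def HLe {K : SSet.{u}} [ZeroInftyCategory K] {A B : K _⦋0⦌} (f g : SSet.Edge A B) : Prop :=
  (ZeroInftyCategory.chpo A B).le f g

/-! ### h-projection pairs -/

/-- `(f⁺, f⁻)` is an h-projection pair from `A` to `B`: the composite "first `f⁺`, then `f⁻`"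
is equivalent to `I_A`, and the composite "first `f⁻`, then `f⁺`" is `≾ I_B`. -/
structure IsHProjectionPair {K : SSet.{u}} [ZeroInftyCategory K] {A B : K _⦋0⦌}
    (fp : SSet.Edge A B) (fm : SSet.Edge B A) : Prop where
  retract : IsComp fp fm (SSet.Edge.id A)
  le_id : ∃ e : SSet.Edge B B, IsComp fm fp e ∧ HLe e (SSet.Edge.id B)

/-- Two `1`-simplices which, with matching (opposite) end points, form an h-projection pair. -/
def IsHProjectionPair₁ {K : SSet.{u}} [ZeroInftyCategory K] (a b : K _⦋1⦌) : Prop :=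
  ∃ (A B : K _⦋0⦌) (fp : SSet.Edge A B) (fm : SSet.Edge B A),
    fp.edge = a ∧ fm.edge = b ∧ IsHProjectionPair fp fm

/-- The simplicial set `K^{HPrj}`, as a subcomplex of `K × Kᵒᵖ`: an `n`-simplex is a pair
`(σ⁺, σ⁻)` of an `n`-simplex of `K` and an `n`-simplex of `Kᵒᵖ` all of whose edges
`(f⁺, f⁻)` are h-projection pairs (for degenerate edges this says that `σ⁺` and `σ⁻` have the
same vertices).  So its vertices are the vertices of `K` and its edges the h-projection pairs. -/
def hprjSubcomplex (K : SSet.{u}) [ZeroInftyCategory K] : (K ⊗ K.op).Subcomplex where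
  obj n := {σ | ∀ e : ⦋1⦌ ⟶ n.unop,
    IsHProjectionPair₁ (K.map e.op σ.1) (SSet.opObjEquiv (K.op.map e.op σ.2))}
  map {n m} φ := by
    intro σ hσ e
    have h := hσ (e ≫ φ.unop)
    simpa using h

/-- The `∞`-category `K^{HPrj}`. -/
abbrev HPrj (K : SSet.{u}) [ZeroInftyCategory K] : SSet.{u} := (hprjSubcomplex K : SSet.{u})

namespace HPrj

variable {K : SSet.{u}} [ZeroInftyCategory K]

lemma isHProjectionPair_id (A : K _⦋0⦌) :
    IsHProjectionPair (SSet.Edge.id A) (SSet.Edge.id A) where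
  retract := ⟨SSet.Edge.CompStruct.idCompId A⟩
  le_id := ⟨SSet.Edge.id A, ⟨SSet.Edge.CompStruct.idCompId A⟩,
    (ZeroInftyCategory.chpo A A).le_of_eqv ⟨SSet.Edge.CompStruct.compId _⟩⟩

/-- The object of `K` underlying a vertex of `K^{HPrj}`. -/
def base (X : HPrj K _⦋0⦌) : K _⦋0⦌ := X.1.1

lemma isHProjectionPair₁_degenerate (A : K _⦋0⦌) :
    IsHProjectionPair₁ (K.σ 0 A) (SSet.opObjEquiv (K.op.σ 0 (SSet.opObjEquiv.symm A))) :=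
  ⟨A, A, SSet.Edge.id A, SSet.Edge.id A, rfl, by simp, isHProjectionPair_id A⟩

/-- The two components of a vertex of `K^{HPrj}` agree. -/
lemma base_eq_snd (X : HPrj K _⦋0⦌) : SSet.opObjEquiv X.1.2 = base X := by
  obtain ⟨A, B, f, g, hf, hg, -⟩ := X.2 (SimplexCategory.σ 0)
  have h₁ : A = base X := by
    rw [← f.src_eq, hf]
    exact SSet.δ_comp_σ_succ_apply (S := K) (0 : Fin 1) X.1.1
  have h₂ : A = SSet.opObjEquiv X.1.2 := by
    rw [← g.tgt_eq, hg, SSet.δ_opObjEquiv]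
    exact congrArg SSet.opObjEquiv (SSet.δ_comp_σ_succ_apply (S := K.op) (0 : Fin 1) X.1.2)
  exact h₂.symm.trans h₁

/-- The object `A` of `K` as a vertex of `K^{HPrj}`. -/
def vertex (A : K _⦋0⦌) : HPrj K _⦋0⦌ :=
  ⟨(A, SSet.opObjEquiv.symm A), by
    intro e
    obtain rfl : e = SimplexCategory.σ 0 := Subsingleton.elim _ _
    exact isHProjectionPair₁_degenerate A⟩

@[simp]
lemma base_vertex (A : K _⦋0⦌) : base (vertex A) = A := rfl

/-- The component `f⁺ : A ⟶ B` of an edge `(f⁺, f⁻)` from `A` to `B` of `K^{HPrj}`. -/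
def plus {X Y : HPrj K _⦋0⦌} (f : SSet.Edge X Y) : SSet.Edge (base X) (base Y) :=
  SSet.Edge.mk f.edge.1.1
    (congrArg base f.src_eq)
    (congrArg base f.tgt_eq)

/-- The component `f⁻ : B ⟶ A` of an edge `(f⁺, f⁻)` from `A` to `B` of `K^{HPrj}`. -/
def minus {X Y : HPrj K _⦋0⦌} (f : SSet.Edge X Y) : SSet.Edge (base Y) (base X) :=
  SSet.Edge.mk (SSet.opObjEquiv f.edge.1.2)
    (by
      rw [SSet.δ_opObjEquiv, ← base_eq_snd]
      exact congrArg (fun Z : HPrj K _⦋0⦌ => SSet.opObjEquiv Z.1.2) f.tgt_eq)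
    (by
      rw [SSet.δ_opObjEquiv, ← base_eq_snd]
      exact congrArg (fun Z : HPrj K _⦋0⦌ => SSet.opObjEquiv Z.1.2) f.src_eq)

/-- The edges of `K^{HPrj}` are h-projection pairs. -/
lemma isHProjectionPair {X Y : HPrj K _⦋0⦌} (f : SSet.Edge X Y) :
    IsHProjectionPair (plus f) (minus f) := by
  obtain ⟨A, B, fp, fm, hp, hm, h⟩ := f.edge.2 (𝟙 _)
  replace hp : fp.edge = (plus f).edge := by rw [hp]; exact congrArg Prod.fst (Functor.map_id_apply (K ⊗ K.op) (Opposite.op ⦋1⦌) f.edge.1)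
  replace hm : fm.edge = (minus f).edge := by rw [hm]; exact congrArg SSet.opObjEquiv (Functor.map_id_apply K.op (Opposite.op ⦋1⦌) f.edge.1.2)
  obtain rfl : A = base X := by rw [← fp.src_eq, hp, (plus f).src_eq]
  obtain rfl : B = base Y := by rw [← fp.tgt_eq, hp, (plus f).tgt_eq]
  obtain rfl := SSet.Edge.ext hp
  obtain rfl := SSet.Edge.ext hm
  exact h

lemma edge_mem {A B : K _⦋0⦌} (fp : SSet.Edge A B) (fm : SSet.Edge B A)
    (h : IsHProjectionPair fp fm) :
    ((fp.edge, SSet.opObjEquiv.symm fm.edge) : (K ⊗ K.op).obj (Opposite.op ⦋1⦌)) ∈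
      (hprjSubcomplex K).obj (Opposite.op ⦋1⦌) := by
  intro e
  have key : ∀ (k : Fin 2) (C : K _⦋0⦌), K.δ k fp.edge = C →
      K.op.δ k (SSet.opObjEquiv.symm fm.edge) = SSet.opObjEquiv.symm C →
      e = SimplexCategory.σ 0 ≫ SimplexCategory.δ k →
      IsHProjectionPair₁ (K.map e.op fp.edge)
        (SSet.opObjEquiv (K.op.map e.op (SSet.opObjEquiv.symm fm.edge))) := by
    rintro k C h₁ h₂ rfl
    have := isHProjectionPair₁_degenerate C
    rw [← h₂] at this
    rw [← h₁] at this
    simpa [SimplicialObject.σ, SimplicialObject.δ] using this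
  have hle : e.toOrderHom 0 ≤ e.toOrderHom 1 := e.toOrderHom.monotone (by simp)
  have hext : ∀ e' : ⦋1⦌ ⟶ ⦋1⦌, e.toOrderHom 0 = e'.toOrderHom 0 →
      e.toOrderHom 1 = e'.toOrderHom 1 → e = e' := by
    intro e' h₀ h₁
    ext i : 3
    fin_cases i
    · exact h₀
    · exact h₁
  generalize e.toOrderHom 0 = a at hle hext
  generalize e.toOrderHom 1 = b at hle hext
  change Fin 2 at a b
  fin_cases a <;> fin_cases b
  · exact key 1 A (by simp) (by simp) (hext _ rfl rfl)
  · obtain rfl := hext (𝟙 _) rfl rfl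
    exact ⟨A, B, fp, fm, by simp, by simp, h⟩
  · exact absurd hle (by decide)
  · exact key 0 B (by simp) (by simp) (hext _ rfl rfl)

/-- An h-projection pair `(f⁺, f⁻)` as an edge of `K^{HPrj}`. -/
def edge {X Y : HPrj K _⦋0⦌} (fp : SSet.Edge (base X) (base Y))
    (fm : SSet.Edge (base Y) (base X)) (h : IsHProjectionPair fp fm) : SSet.Edge X Y :=
  SSet.Edge.mk ⟨(fp.edge, SSet.opObjEquiv.symm fm.edge), edge_mem fp fm h⟩
    (by
      refine Subtype.ext (Prod.ext fp.src_eq (SSet.opObjEquiv.injective ?_))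
      exact (SSet.δ_opObjEquiv (X := K) 0 (SSet.opObjEquiv.symm fm.edge)).symm.trans
        (fm.tgt_eq.trans (base_eq_snd X).symm))
    (by
      refine Subtype.ext (Prod.ext fp.tgt_eq (SSet.opObjEquiv.injective ?_))
      exact (SSet.δ_opObjEquiv (X := K) 1 (SSet.opObjEquiv.symm fm.edge)).symm.trans
        (fm.src_eq.trans (base_eq_snd Y).symm))

end HPrj

/-- The `ω`ᵒᵖ-diagram `({K_i}, {f_i⁻})` of the projections of an `ω`-diagram in `K^{HPrj}`. -/
def OmegaDiagram.projections {K : SSet.{u}} [ZeroInftyCategory K]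
    (D : OmegaDiagram (HPrj K)) : OmegaOpDiagram K where
  obj i := HPrj.base (D.obj i)
  map i := HPrj.minus (D.map i)

end HDom

/-! Everything asserted is about 2-simplices up to equivalence, so it can be checked in the homotopy
category. There the Cantor–Schröder–Bernstein property turns the homotopy order into a partial order
on each hom-set, with suprema of chains and continuous composition, and the claim becomes the
classical limit-colimit coincidence.

For fixed `i` the maps `transition e p i j` form a cone over the projections, whose lift is an
embedding `δ i` for `γ i`. The increasing maps `γ i ≫ δ i` have supremum `𝟙 L`
(`isLUB_cone_comp_cocone`). For a cocone `(τp, τm)`, the mediating projection is the lift of `τm`,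
and the mediating embedding is the supremum of `γ i ≫ τp i`. Uniqueness of the projection comes from
the limit; a projection determines its embedding (`embedding_unique`). Composition in `HPrj K` is
componentwise (`isComp_iff_plus_minus`), which carries the result back. -/

namespace SSet

/-! ### Inner horn filling in dimensions two and three -/

/-- In a quasicategory, every compatible family of faces of an inner horn is filled by a simplex. -/
lemma Quasicategory.exists_simplex {X : SSet.{u}} [X.Quasicategory] {n : ℕ} (i : Fin (n + 3))
    (h₀ : 0 < i) (hn : i < Fin.last (n + 2)) (s : Fin (n + 3) → X _⦋n + 1⦌)
    (hs : ∀ (j k : Fin (n + 3)) (_ : j ≠ i) (_ : k ≠ i) (hjk : j < k),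
      X.δ (k.pred (Fin.ne_zero_of_lt hjk)) (s j) =
        X.δ (j.castPred (Fin.ne_last_of_lt hjk)) (s k)) :
    ∃ σ : X _⦋n + 2⦌, ∀ j, j ≠ i → X.δ j σ = s j := by
  have hc : horn.IsCompatible (i := i) (fun j _ => yonedaEquiv.symm (s j)) := by
    rw [horn.isCompatible_iff]
    intro j k hj hk hjk
    rw [stdSimplex.δ_comp_yonedaEquiv_symm, stdSimplex.δ_comp_yonedaEquiv_symm, hs j k hj hk hjk]
  obtain ⟨φ, hφ⟩ := hc.exists_desc
  obtain ⟨σ, rfl⟩ := Quasicategory.hornFilling h₀ hn φ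
  refine ⟨yonedaEquiv σ, fun j hj => yonedaEquiv.symm.injective ?_⟩
  rw [← hφ j hj, ← stdSimplex.δ_comp_yonedaEquiv_symm, Equiv.symm_apply_apply,
    ← Category.assoc, horn.ι_ι]

/-- The `2`-truncation of a quasicategory is a `2`-truncated quasicategory. -/
instance Quasicategory.quasicategory₂ (X : SSet.{u}) [X.Quasicategory] :
    ((truncation 2).obj X).Quasicategory₂ where
  fill21 {x₀ x₁ x₂} e₀₁ e₁₂ := by
    obtain ⟨σ, hσ⟩ := Quasicategory.exists_simplex (X := X) 1 (by simp) (by decide)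
      ![e₁₂.edge, e₁₂.edge, e₀₁.edge] (by
        intro j k hj hk hjk
        obtain ⟨rfl, rfl⟩ : j = 0 ∧ k = 2 := by lia
        exact e₁₂.src_eq.trans e₀₁.tgt_eq.symm)
    have h₂ : X.δ 2 σ = e₀₁.edge := hσ 2 (by decide)
    have h₀ : X.δ 0 σ = e₁₂.edge := hσ 0 (by decide)
    refine ⟨⟨Edge.mk (X := X) (X.δ 1 σ) ?_ ?_, Edge.CompStruct.mk (X := X) σ h₂ h₀ rfl⟩⟩
    · refine Eq.trans ?_ e₀₁.src_eq
      rw [← h₂]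
      exact (SSet.δ_comp_δ_apply (S := X) (i := 1) (j := 1) le_rfl σ).symm
    · refine Eq.trans ?_ e₁₂.tgt_eq
      rw [← h₀]
      exact SSet.δ_comp_δ_apply (S := X) (i := 0) (j := 0) le_rfl σ
  fill31 {x₀ x₁ x₂ x₃ e₀₁ e₁₂ e₂₃ e₀₂ e₁₃ e₀₃} f₃ f₀ f₂ := by
    obtain ⟨σ, hσ⟩ := Quasicategory.exists_simplex (X := X) 1 (by simp) (by decide)
      ![f₀.simplex, f₀.simplex, f₂.simplex, f₃.simplex] (by
        intro j k hj hk hjk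
        obtain ⟨rfl, rfl⟩ | ⟨rfl, rfl⟩ | ⟨rfl, rfl⟩ :
          (j = 0 ∧ k = 2) ∨ (j = 0 ∧ k = 3) ∨ (j = 2 ∧ k = 3) := by lia
        · exact f₀.d₁.trans f₂.d₀.symm
        · exact f₀.d₂.trans f₃.d₀.symm
        · exact f₂.d₂.trans f₃.d₂.symm)
    have h₀ : X.δ 0 σ = f₀.simplex := hσ 0 (by decide)
    have h₂ : X.δ 2 σ = f₂.simplex := hσ 2 (by decide)
    have h₃ : X.δ 3 σ = f₃.simplex := hσ 3 (by decide)
    refine ⟨Edge.CompStruct.mk (X := X) (X.δ 1 σ) ?_ ?_ ?_⟩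
    · refine Eq.trans ?_ f₃.d₁
      rw [← h₃]
      exact (SSet.δ_comp_δ_apply (S := X) (i := 1) (j := 2) (by decide) σ).symm
    · refine Eq.trans ?_ f₀.d₀
      rw [← h₀]
      exact SSet.δ_comp_δ_apply (S := X) (i := 0) (j := 0) le_rfl σ
    · refine Eq.trans ?_ f₂.d₁
      rw [← h₂]
      exact (SSet.δ_comp_δ_apply (S := X) (i := 1) (j := 1) le_rfl σ).symm
  fill32 {x₀ x₁ x₂ x₃ e₀₁ e₁₂ e₂₃ e₀₂ e₁₃ e₀₃} f₃ f₀ f₁ := by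
    obtain ⟨σ, hσ⟩ := Quasicategory.exists_simplex (X := X) 2 (by simp) (by decide)
      ![f₀.simplex, f₁.simplex, f₀.simplex, f₃.simplex] (by
        intro j k hj hk hjk
        obtain ⟨rfl, rfl⟩ | ⟨rfl, rfl⟩ | ⟨rfl, rfl⟩ :
          (j = 0 ∧ k = 1) ∨ (j = 0 ∧ k = 3) ∨ (j = 1 ∧ k = 3) := by lia
        · exact f₀.d₀.trans f₁.d₀.symm
        · exact f₀.d₂.trans f₃.d₀.symm
        · exact f₁.d₂.trans f₃.d₁.symm)
    have h₀ : X.δ 0 σ = f₀.simplex := hσ 0 (by decide)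
    have h₁ : X.δ 1 σ = f₁.simplex := hσ 1 (by decide)
    have h₃ : X.δ 3 σ = f₃.simplex := hσ 3 (by decide)
    refine ⟨Edge.CompStruct.mk (X := X) (X.δ 2 σ) ?_ ?_ ?_⟩
    · refine Eq.trans ?_ f₃.d₂
      rw [← h₃]
      exact (SSet.δ_comp_δ_apply (S := X) (i := 2) (j := 2) le_rfl σ).symm
    · refine Eq.trans ?_ f₀.d₁
      rw [← h₀]
      exact SSet.δ_comp_δ_apply (S := X) (i := 0) (j := 1) (by decide) σ
    · refine Eq.trans ?_ f₁.d₁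
      rw [← h₁]
      exact SSet.δ_comp_δ_apply (S := X) (i := 1) (j := 1) le_rfl σ

end SSet

namespace CategoryTheory

/-! ### Transition maps along a sequence of embeddings and projections -/

section Transition

variable {C : Type*} [Category C]

/-- The transition morphism `X i ⟶ X j`, an iterated embedding for `i ≤ j` and an iterated
projection for `j ≤ i`. -/
def transition {X : ℕ → C} (e : ∀ i, X i ⟶ X (i + 1)) (p : ∀ i, X (i + 1) ⟶ X i) :
    (i j : ℕ) → (X i ⟶ X j) := fun i j =>
  match i, j with
  | 0, 0 => 𝟙 _
  | 0, j + 1 => transition e p 0 j ≫ e j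
  | i + 1, 0 => p i ≫ transition e p i 0
  -- Shifting the whole sequence avoids both a case split on `i ≤ j` and casts between objects.
  | i + 1, j + 1 =>
      transition (X := fun n => X (n + 1)) (fun n => e (n + 1)) (fun n => p (n + 1)) i j

variable {X : ℕ → C} {e : ∀ i, X i ⟶ X (i + 1)} {p : ∀ i, X (i + 1) ⟶ X i}

lemma transition_succ_succ (i j : ℕ) : transition e p (i + 1) (j + 1) =
    transition (X := fun n => X (n + 1)) (fun n => e (n + 1)) (fun n => p (n + 1)) i j := by
  rw [transition]

@[simp]
lemma transition_self (i : ℕ) : transition e p i i = 𝟙 (X i) := by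
  induction i generalizing X with
  | zero => simp [transition]
  | succ i ih => rw [transition, ih]

/-- For `i ≤ j` the last embedding cancels against `p j`; for `j < i` one more projection is
appended. Thus, for fixed `i`, the transitions are a cone over the projections. -/
lemma transition_succ_comp (h : ∀ i, e i ≫ p i = 𝟙 (X i)) (i j : ℕ) :
    transition e p i (j + 1) ≫ p j = transition e p i j := by
  induction i generalizing X j with
  | zero => simp [transition, h]
  | succ i ih =>
    rcases j with _ | j
    · rcases i with _ | i
      · simp [transition]
      · have := ih h 0
        simp only [transition, Category.assoc] at this ⊢
        rw [this]
    · simp only [transition_succ_succ]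
      exact ih (X := fun n => X (n + 1)) (fun n => h (n + 1)) j

lemma comp_transition_succ (h : ∀ i, e i ≫ p i = 𝟙 (X i)) (i j : ℕ) :
    e i ≫ transition e p (i + 1) j = transition e p i j := by
  induction j generalizing X i with
  | zero => simp [transition, reassoc_of% h]
  | succ j ih =>
    rcases i with _ | i
    · rcases j with _ | j
      · simp [transition]
      · have := ih h 0
        simp only [transition] at this ⊢
        rw [← this, Category.assoc]
    · simp only [transition_succ_succ]
      exact ih (X := fun n => X (n + 1)) (fun n => h (n + 1)) i

/-- The bound `j ≤ i` ensures that the transition consists of projections only, which the cone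
absorbs. -/
lemma cone_comp_transition {T : C} {τ : ∀ i, T ⟶ X i} (hτ : ∀ i, τ (i + 1) ≫ p i = τ i)
    {i j : ℕ} (hij : j ≤ i) : τ i ≫ transition e p i j = τ j := by
  induction i generalizing X j with
  | zero =>
    obtain rfl : j = 0 := by lia
    simp
  | succ i ih =>
    rcases j with _ | j
    · simp [transition, reassoc_of% hτ, ih hτ]
    · rw [transition_succ_succ]
      exact ih (X := fun n => X (n + 1)) (τ := fun n => τ (n + 1)) (fun n => hτ (n + 1))
        (Nat.le_of_succ_le_succ hij)

lemma transition_comp_cocone {T : C} {τ : ∀ i, X i ⟶ T} (hτ : ∀ i, e i ≫ τ (i + 1) = τ i)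
    {i j : ℕ} (hij : i ≤ j) : transition e p i j ≫ τ j = τ i := by
  induction j generalizing X i with
  | zero =>
    obtain rfl : i = 0 := by lia
    simp
  | succ j ih =>
    rcases i with _ | i
    · simp [transition, hτ, ih hτ]
    · rw [transition_succ_succ]
      exact ih (X := fun n => X (n + 1)) (τ := fun n => τ (n + 1)) (fun n => hτ (n + 1))
        (Nat.le_of_succ_le_succ hij)

/-- In a cocone of projection pairs, `τ⁻_j . τ⁺_i` is the transition morphism. -/
lemma cocone_comp_cone_eq_transition {T : C} {τp : ∀ i, X i ⟶ T} {τm : ∀ i, T ⟶ X i}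
    (hp : ∀ i, e i ≫ τp (i + 1) = τp i) (hm : ∀ i, τm (i + 1) ≫ p i = τm i)
    (h : ∀ i, τp i ≫ τm i = 𝟙 (X i)) (i j : ℕ) : τp i ≫ τm j = transition e p i j := by
  -- The leg of smaller index factors through the object of larger index, where the retraction
  -- cancels.
  rcases le_total i j with hij | hij
  · rw [← transition_comp_cocone (p := p) hp hij, Category.assoc, h, Category.comp_id]
  · rw [← cone_comp_transition (e := e) hm hij, reassoc_of% h]

end Transition

/-! ### Order-enriched categories and projection pairs -/

lemma isLUB_const {α : Type*} [PartialOrder α] (f : α) : IsLUB (Set.range fun _ : ℕ => f) f := by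
  rw [Set.range_const]
  exact isLUB_singleton

/-- A category whose hom-sets are `ω`-complete partial orders and whose composition is
`ω`-continuous. -/
class OmegaContinuousCategory (C : Type*) [Category C] [∀ A B : C, PartialOrder (A ⟶ B)] :
    Prop where
  exists_isLUB {A B : C} (p : ℕ → (A ⟶ B)) : Monotone p → ∃ s, IsLUB (Set.range p) s
  comp_isLUB {A B D : C} {p : ℕ → (A ⟶ B)} {q : ℕ → (B ⟶ D)} {s : A ⟶ B} {t : B ⟶ D} :
    Monotone p → Monotone q → IsLUB (Set.range p) s → IsLUB (Set.range q) t →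
      IsLUB (Set.range fun i => p i ≫ q i) (s ≫ t)

/-- If a monotone sequence is eventually equal to `c`, its least upper bound is `c`. -/
lemma eq_of_isLUB_of_eventually_eq {α : Type*} [PartialOrder α] {p : ℕ → α} (hp : Monotone p)
    {s c : α} (hs : IsLUB (Set.range p) s) (N : ℕ) (hc : ∀ i, N ≤ i → p i = c) : s = c := by
  refine hs.unique ⟨?_, fun b hb => hc N le_rfl ▸ hb ⟨N, rfl⟩⟩
  rintro _ ⟨i, rfl⟩
  rw [← hc (max i N) (le_max_right i N)]
  exact hp (le_max_left i N)

namespace OmegaContinuousCategory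

variable {C : Type*} [Category C] [∀ A B : C, PartialOrder (A ⟶ B)]
  [OmegaContinuousCategory C]

lemma comp_isLUB_left {A B D : C} (f : A ⟶ B) {q : ℕ → (B ⟶ D)} {t : B ⟶ D} (hq : Monotone q)
    (ht : IsLUB (Set.range q) t) : IsLUB (Set.range fun i => f ≫ q i) (f ≫ t) :=
  comp_isLUB monotone_const hq (isLUB_const f) ht

lemma comp_isLUB_right {A B D : C} {p : ℕ → (A ⟶ B)} {s : A ⟶ B} (g : B ⟶ D) (hp : Monotone p)
    (hs : IsLUB (Set.range p) s) : IsLUB (Set.range fun i => p i ≫ g) (s ≫ g) :=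
  comp_isLUB hp monotone_const hs (isLUB_const g)

/-- Monotonicity follows from continuity applied to the chains `f, f', f', …` and `g, g', g', …`,
whose suprema are `f'` and `g'`. -/
lemma comp_mono {A B D : C} {f f' : A ⟶ B} {g g' : B ⟶ D} (hf : f ≤ f') (hg : g ≤ g') :
    f ≫ g ≤ f' ≫ g' := by
  have aux : ∀ {A B : C} {f f' : A ⟶ B}, f ≤ f' →
      Monotone (fun i : ℕ => if i = 0 then f else f') ∧
        IsLUB (Set.range (fun i : ℕ => if i = 0 then f else f')) f' := by
    intro A B f f' h
    refine ⟨monotone_nat_of_le_succ fun i => ?_, ?_, fun b hb => hb ⟨1, rfl⟩⟩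
    · rcases i with _ | i <;> simp [h]
    · rintro _ ⟨i, rfl⟩
      dsimp only
      split_ifs
      exacts [h, le_rfl]
  exact (comp_isLUB (aux hf).1 (aux hg).1 (aux hf).2 (aux hg).2).1 ⟨0, rfl⟩

/-- An embedding-projection pair `f : A ⟶ B`, `g : B ⟶ A`. -/
structure IsProjectionPair {A B : C} (f : A ⟶ B) (g : B ⟶ A) : Prop where
  retract : f ≫ g = 𝟙 A
  le_id : g ≫ f ≤ 𝟙 B

namespace IsProjectionPair

lemma comp {A B D : C} {f : A ⟶ B} {g : B ⟶ A} {f' : B ⟶ D} {g' : D ⟶ B}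
    (h : IsProjectionPair f g) (h' : IsProjectionPair f' g') :
    IsProjectionPair (f ≫ f') (g' ≫ g) where
  retract := by simp [reassoc_of% h'.retract, h.retract]
  le_id := by
    have := comp_mono (le_refl g') (comp_mono h.le_id (le_refl f'))
    simpa using this.trans (by simpa using h'.le_id)

/-- In diagrammatic order, `f = f' ≫ g ≫ f ≤ f'`. -/
lemma le_of_projection_eq {A B : C} {f f' : A ⟶ B} {g : B ⟶ A} (h : IsProjectionPair f g)
    (h' : IsProjectionPair f' g) : f ≤ f' := by
  simpa [reassoc_of% h'.retract] using comp_mono (le_refl f') h.le_id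

/-- The embedding of a projection pair is determined by the projection. -/
lemma embedding_unique {A B : C} {f f' : A ⟶ B} {g : B ⟶ A} (h : IsProjectionPair f g)
    (h' : IsProjectionPair f' g) : f = f' :=
  (h.le_of_projection_eq h').antisymm (h'.le_of_projection_eq h)

end IsProjectionPair

/-! ### Limit-colimit coincidence -/

section Sequence

variable {X : ℕ → C} {e : ∀ i, X i ⟶ X (i + 1)} {p : ∀ i, X (i + 1) ⟶ X i}

/-- The composites of a cone with a cocone form a monotone sequence. -/
lemma monotone_cone_comp_cocone (hep : ∀ i, p i ≫ e i ≤ 𝟙 (X (i + 1))) {S T : C}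
    {σ : ∀ i, S ⟶ X i} {τ : ∀ i, X i ⟶ T} (hσ : ∀ i, σ (i + 1) ≫ p i = σ i)
    (hτ : ∀ i, e i ≫ τ (i + 1) = τ i) : Monotone fun i => σ i ≫ τ i := by
  refine monotone_nat_of_le_succ fun i => ?_
  rw [← hσ, ← hτ]
  simpa using comp_mono (le_refl (σ (i + 1))) (comp_mono (hep i) (le_refl (τ (i + 1))))

variable (p) in
/-- `(L, γ)` is a limit of the sequence `X 0 ⟵ X 1 ⟵ ⋯` of the `p i`. -/
structure IsSequentialLimit (L : C) (γ : ∀ i, L ⟶ X i) : Prop where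
  cone : ∀ i, γ (i + 1) ≫ p i = γ i
  exists_lift : ∀ {T : C} (τ : ∀ i, T ⟶ X i), (∀ i, τ (i + 1) ≫ p i = τ i) →
    ∃ h : T ⟶ L, ∀ i, h ≫ γ i = τ i
  hom_ext : ∀ {T : C} {h h' : T ⟶ L}, (∀ i, h ≫ γ i = h' ≫ γ i) → h = h'

namespace IsSequentialLimit

variable {L : C} {γ : ∀ i, L ⟶ X i} (hL : IsSequentialLimit p L γ)
  (hep : ∀ i, IsProjectionPair (e i) (p i))

include hL hep

/-- After composition with `γ j` the sequence is constantly `γ j` from index `j` on. By continuity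
its supremum `s` satisfies `s ≫ γ j = γ j` for every `j`, so `s` is the identity. -/
lemma isLUB_cone_comp_cocone {δ : ∀ i, X i ⟶ L} (hδ : ∀ i j, δ i ≫ γ j = transition e p i j) :
    IsLUB (Set.range fun i => γ i ≫ δ i) (𝟙 L) := by
  have hδe : ∀ i, e i ≫ δ (i + 1) = δ i := fun i => hL.hom_ext fun j => by
    rw [Category.assoc, hδ, hδ, comp_transition_succ fun i => (hep i).retract]
  have hmono := monotone_cone_comp_cocone (fun i => (hep i).le_id) hL.cone hδe
  obtain ⟨s, hs⟩ := exists_isLUB _ hmono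
  suffices s = 𝟙 L by rwa [← this]
  refine hL.hom_ext fun j => ?_
  rw [Category.id_comp]
  refine eq_of_isLUB_of_eventually_eq (fun a b hab => comp_mono (hmono hab) le_rfl)
    (comp_isLUB_right (γ j) hmono hs) j fun i hij => ?_
  rw [Category.assoc, hδ, cone_comp_transition hL.cone hij]

/-- The projections of the limit cone have embeddings. -/
lemma exists_isProjectionPair (i : ℕ) : ∃ δ : X i ⟶ L, IsProjectionPair δ (γ i) := by
  choose δ hδ using fun i => hL.exists_lift (transition e p i)
    (transition_succ_comp (fun i => (hep i).retract) i)
  exact ⟨δ i, by rw [hδ, transition_self], (hL.isLUB_cone_comp_cocone hep hδ).1 ⟨i, rfl⟩⟩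

variable {δ : ∀ i, X i ⟶ L} (hδ : ∀ i, IsProjectionPair (δ i) (γ i))

include hδ

/-- Both sides are embeddings for the same projection `γ (i + 1) ≫ p i = γ i`, so they agree for any
choice of `δ`. -/
lemma embedding_cocone (i : ℕ) : e i ≫ δ (i + 1) = δ i := by
  have := (hep i).comp (hδ (i + 1))
  rw [hL.cone] at this
  exact this.embedding_unique (hδ i)

/-- The mediating projection pair out of the limit of the projections. -/
lemma exists_isProjectionPair_desc {T : C} {τp : ∀ i, X i ⟶ T} {τm : ∀ i, T ⟶ X i}
    (hτ : ∀ i, IsProjectionPair (τp i) (τm i)) (hp : ∀ i, e i ≫ τp (i + 1) = τp i)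
    (hm : ∀ i, τm (i + 1) ≫ p i = τm i) :
    ∃ (f : L ⟶ T) (g : T ⟶ L), IsProjectionPair f g ∧ (∀ i, δ i ≫ f = τp i) ∧
      ∀ i, g ≫ γ i = τm i := by
  have hδe := hL.embedding_cocone hep hδ
  have hδγ := cocone_comp_cone_eq_transition hδe hL.cone fun i => (hδ i).retract
  have hτpm := cocone_comp_cone_eq_transition hp hm fun i => (hτ i).retract
  obtain ⟨g, hg⟩ := hL.exists_lift τm hm
  have hmono := monotone_cone_comp_cocone (fun i => (hep i).le_id) hL.cone hp
  obtain ⟨f, hf⟩ := exists_isLUB _ hmono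
  refine ⟨f, g, ⟨?_, ?_⟩, fun i => ?_, hg⟩
  -- Hence `f ≫ g` is the supremum of the `γ i ≫ δ i`, namely the identity.
  · have hτg : ∀ i, τp i ≫ g = δ i := fun i => hL.hom_ext fun j => by
      rw [Category.assoc, hg, hτpm, hδγ]
    have := comp_isLUB_right g hmono hf
    simp only [Category.assoc, hτg] at this
    exact this.unique (hL.isLUB_cone_comp_cocone hep hδγ)
  -- Here `g ≫ f` is the supremum of the `τm i ≫ τp i`, each below the identity.
  · have := comp_isLUB_left g hmono hf
    simp only [reassoc_of% hg] at this
    refine this.2 ?_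
    rintro _ ⟨i, rfl⟩
    exact (hτ i).le_id
  -- The terms `δ i ≫ γ j ≫ τp j` equal `τp i` once `i ≤ j`.
  · refine eq_of_isLUB_of_eventually_eq (fun a b hab => comp_mono le_rfl (hmono hab))
      (comp_isLUB_left (δ i) hmono hf) i fun j hij => ?_
    rw [← Category.assoc, hδγ, transition_comp_cocone hp hij]

end IsSequentialLimit

end Sequence

end OmegaContinuousCategory

end CategoryTheory

namespace HDom

open SSet.Truncated OmegaContinuousCategory

/-! ### Passage to the homotopy category -/

section HomotopyCategory

/-- The homotopy category of a quasicategory. -/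
abbrev HoCat (X : SSet.{u}) : Type u := HomotopyCategory₂ ((SSet.truncation 2).obj X)

variable {X : SSet.{u}} [X.Quasicategory]

/-- The object of the homotopy category given by a vertex. -/
def hoObj (A : X _⦋0⦌) : HoCat X := HomotopyCategory₂.mk A

/-- The morphism of the homotopy category represented by an edge. -/
def hoMap {A B : X _⦋0⦌} (f : SSet.Edge A B) : hoObj A ⟶ hoObj B :=
  HomotopyCategory₂.homMk f.toTruncated

lemma hoMap_surjective {A B : X _⦋0⦌} :
    Function.Surjective (hoMap : SSet.Edge A B → (hoObj A ⟶ hoObj B)) :=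
  HomotopyCategory₂.homMk_surjective

@[simp]
lemma hoMap_id (A : X _⦋0⦌) : hoMap (SSet.Edge.id A) = 𝟙 (hoObj A) := rfl

lemma isComp_iff {A B C : X _⦋0⦌} {f : SSet.Edge A B} {g : SSet.Edge B C} {h : SSet.Edge A C} :
    IsComp f g h ↔ hoMap f ≫ hoMap g = hoMap h :=
  SSet.Truncated.Edge.CompStruct.nonempty_iff

lemma homotopic_iff {A B : X _⦋0⦌} {f g : SSet.Edge A B} :
    Homotopic f g ↔ hoMap f = hoMap g :=
  (isComp_iff (g := SSet.Edge.id B)).trans (by rw [hoMap_id, Category.comp_id])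

/-- A limit of an `ω`ᵒᵖ-diagram is a limit in the homotopy category. -/
lemma OmegaOpDiagram.IsLimit.isSequentialLimit {D : OmegaOpDiagram X} {L : X _⦋0⦌}
    {γ : ∀ i, SSet.Edge L (D.obj i)} (hL : D.IsLimit L γ) :
    IsSequentialLimit (fun i => hoMap (D.map i)) (hoObj L) (fun i => hoMap (γ i)) where
  cone i := isComp_iff.1 (hL.cone i)
  exists_lift {T} τ hτ := by
    choose τ' hτ' using fun i => hoMap_surjective (A := T.pt) (τ i)
    obtain rfl : (fun i => hoMap (τ' i)) = τ := funext hτ'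
    obtain ⟨h, hh⟩ := hL.exists_mediating T.pt τ' fun i => isComp_iff.2 (hτ i)
    exact ⟨hoMap h, fun i => isComp_iff.1 (hh i)⟩
  hom_ext {T h h'} hh := by
    obtain ⟨h, rfl⟩ := hoMap_surjective (A := T.pt) h
    obtain ⟨h', rfl⟩ := hoMap_surjective (A := T.pt) h'
    -- Uniqueness of mediating edges refers to a cone of edges, so representatives of the common
    -- composites are chosen.
    choose τ hτ using fun i => hoMap_surjective (A := T.pt) (hoMap h ≫ hoMap (γ i))
    refine homotopic_iff.1 (hL.unique_mediating T.pt τ (fun i => isComp_iff.2 ?_) h h'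
      (fun i => isComp_iff.2 (hτ i).symm) fun i => isComp_iff.2 ((hh i).symm.trans (hτ i).symm))
    rw [hτ, hτ, Category.assoc, isComp_iff.1 (hL.cone i)]

end HomotopyCategory

/-! ### The homotopy order on the homotopy category -/

section ZeroInfty

variable {K : SSet.{u}} [ZeroInftyCategory K]

lemma hLe_of_hoMap_eq {A B : K _⦋0⦌} {f g : SSet.Edge A B} (h : hoMap f = hoMap g) : HLe f g :=
  (ZeroInftyCategory.chpo A B).le_of_eqv (homotopic_iff.2 h)

lemma HLe.trans {A B : K _⦋0⦌} {f g h : SSet.Edge A B} (hfg : HLe f g) (hgh : HLe g h) :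
    HLe f h :=
  (ZeroInftyCategory.chpo A B).le_trans hfg hgh

/-- The homotopy order as a partial order on the morphisms of the homotopy category. -/
instance (A B : HoCat K) : PartialOrder (A ⟶ B) where
  le a b := ∃ f g : SSet.Edge (X := K) A.pt B.pt, hoMap f = a ∧ hoMap g = b ∧ HLe f g
  le_refl a := by
    obtain ⟨f, rfl⟩ := hoMap_surjective a
    exact ⟨f, f, rfl, rfl, hLe_of_hoMap_eq rfl⟩
  le_trans := by
    rintro _ _ _ ⟨f, g, rfl, rfl, hfg⟩ ⟨g', h, hg, rfl, hgh⟩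
    exact ⟨f, h, rfl, rfl, (hfg.trans (hLe_of_hoMap_eq hg.symm)).trans hgh⟩
  le_antisymm := by
    rintro _ _ ⟨f, g, rfl, rfl, hfg⟩ ⟨g', f', hg, hf, hgf⟩
    exact homotopic_iff.1 ((ZeroInftyCategory.chpo _ _).csb hfg
      (((hLe_of_hoMap_eq hg.symm).trans hgf).trans (hLe_of_hoMap_eq hf)))

lemma hoMap_le_hoMap_iff {A B : K _⦋0⦌} {f g : SSet.Edge A B} :
    hoMap f ≤ hoMap g ↔ HLe f g := by
  constructor
  · rintro ⟨f', g', hf, hg, h⟩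
    exact ((hLe_of_hoMap_eq hf.symm).trans h).trans (hLe_of_hoMap_eq hg)
  · exact fun h => ⟨f, g, rfl, rfl, h⟩

lemma isLUB_hoMap_iff {A B : K _⦋0⦌} {p : ℕ → SSet.Edge A B} {s : SSet.Edge A B} :
    IsLUB (Set.range fun i => hoMap (p i)) (hoMap s) ↔
      (ZeroInftyCategory.chpo A B).toHPO.IsSup p s := by
  constructor
  · refine fun h => ⟨fun i => hoMap_le_hoMap_iff.1 (h.1 ⟨i, rfl⟩),
      fun t ht => hoMap_le_hoMap_iff.1 (h.2 ?_)⟩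
    rintro _ ⟨i, rfl⟩
    exact hoMap_le_hoMap_iff.2 (ht i)
  · refine fun h => ⟨?_, fun t ht => ?_⟩
    · rintro _ ⟨i, rfl⟩
      exact hoMap_le_hoMap_iff.2 (h.le_sup i)
    · obtain ⟨t, rfl⟩ := hoMap_surjective t
      exact hoMap_le_hoMap_iff.2 (h.sup_le t fun i => hoMap_le_hoMap_iff.1 (ht ⟨i, rfl⟩))

instance : OmegaContinuousCategory (HoCat K) where
  exists_isLUB {A B} p hp := by
    choose p' hp' using fun i => hoMap_surjective (A := A.pt) (B := B.pt) (p i)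
    obtain rfl : (fun i => hoMap (p' i)) = p := funext hp'
    obtain ⟨s, hs⟩ := (ZeroInftyCategory.chpo A.pt B.pt).exists_sup p'
      fun i => hoMap_le_hoMap_iff.1 (hp i.le_succ)
    exact ⟨hoMap s, isLUB_hoMap_iff.2 hs⟩
  comp_isLUB {A B C p q s t} hp hq hs ht := by
    choose p' hp' using fun i => hoMap_surjective (A := A.pt) (B := B.pt) (p i)
    obtain rfl : (fun i => hoMap (p' i)) = p := funext hp'
    choose q' hq' using fun i => hoMap_surjective (A := B.pt) (B := C.pt) (q i)
    obtain rfl : (fun i => hoMap (q' i)) = q := funext hq'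
    obtain ⟨s, rfl⟩ := hoMap_surjective (A := A.pt) (B := B.pt) s
    obtain ⟨t, rfl⟩ := hoMap_surjective (A := B.pt) (B := C.pt) t
    choose r hr using fun i =>
      hoMap_surjective (A := A.pt) (B := C.pt) (hoMap (p' i) ≫ hoMap (q' i))
    obtain ⟨v, hv⟩ := hoMap_surjective (A := A.pt) (B := C.pt) (hoMap s ≫ hoMap t)
    have h := isLUB_hoMap_iff.2 <| ZeroInftyCategory.comp_continuous p' q' r s t v
      (fun i => hoMap_le_hoMap_iff.1 (hp i.le_succ)) (fun i => hoMap_le_hoMap_iff.1 (hq i.le_succ))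
      (fun i => isComp_iff.2 (hr i).symm) (isComp_iff.2 hv.symm)
      (isLUB_hoMap_iff.1 hs) (isLUB_hoMap_iff.1 ht)
    rw [hv, funext hr] at h
    exact h

lemma isHProjectionPair_iff {A B : K _⦋0⦌} {f : SSet.Edge A B} {g : SSet.Edge B A} :
    IsHProjectionPair f g ↔ IsProjectionPair (hoMap f) (hoMap g) := by
  constructor
  · rintro ⟨h, e, he, hle⟩
    exact ⟨isComp_iff.1 h, (isComp_iff.1 he).trans_le (hoMap_le_hoMap_iff.2 hle)⟩
  · rintro ⟨h, hle⟩
    obtain ⟨e, he⟩ := hoMap_surjective (hoMap g ≫ hoMap f)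
    rw [← he, ← hoMap_id, hoMap_le_hoMap_iff] at hle
    exact ⟨isComp_iff.2 h, e, isComp_iff.2 he.symm, hle⟩

/-! ### Composition and equivalence of h-projection pairs -/

namespace HPrj

@[simp]
lemma plus_id (X : HPrj K _⦋0⦌) : plus (SSet.Edge.id X) = SSet.Edge.id (base X) := rfl

@[simp]
lemma minus_id (X : HPrj K _⦋0⦌) : minus (SSet.Edge.id X) = SSet.Edge.id (base X) := by
  refine SSet.Edge.ext ?_
  exact (SSet.σ_opObjEquiv K 0 X.1.2).symm.trans (congrArg (K.σ 0) (base_eq_snd X))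

/-- Two vertices cannot cover three, so every map `⦋1⦌ ⟶ ⦋2⦌` factors through a face. -/
lemma mem_hprjSubcomplex_of_faces (σ : (K ⊗ K.op : SSet.{u}) _⦋2⦌)
    (hσ : ∀ k : Fin 3, (K ⊗ K.op).δ k σ ∈ (hprjSubcomplex K).obj (Opposite.op ⦋1⦌)) :
    σ ∈ (hprjSubcomplex K).obj (Opposite.op ⦋2⦌) := by
  intro e
  obtain ⟨k, e, rfl⟩ := SimplexCategory.eq_comp_δ_of_not_surjective e fun h => by
    simpa using Fintype.card_le_of_surjective _ h
  simpa [SimplicialObject.δ] using hσ k e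

/-- Composition in `K^{HPrj}` is composition of both components. -/
lemma isComp_iff_plus_minus {X Y Z : HPrj K _⦋0⦌} {f : SSet.Edge X Y} {g : SSet.Edge Y Z}
    {h : SSet.Edge X Z} : IsComp f g h ↔
      IsComp (plus f) (plus g) (plus h) ∧ IsComp (minus g) (minus f) (minus h) := by
  constructor
  · rintro ⟨s⟩
    refine ⟨⟨.mk s.simplex.1.1 ?_ ?_ ?_⟩, ⟨.mk (SSet.opObjEquiv s.simplex.1.2) ?_ ?_ ?_⟩⟩
    · exact congrArg (fun a => a.1.1) s.d₂
    · exact congrArg (fun a => a.1.1) s.d₀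
    · exact congrArg (fun a => a.1.1) s.d₁
    -- The opposite reverses the order of vertices, exchanging faces 0 and 2.
    · exact (SSet.δ_opObjEquiv K 2 s.simplex.1.2).trans
        (congrArg (fun a => SSet.opObjEquiv a.1.2) s.d₀)
    · exact (SSet.δ_opObjEquiv K 0 s.simplex.1.2).trans
        (congrArg (fun a => SSet.opObjEquiv a.1.2) s.d₂)
    · exact (SSet.δ_opObjEquiv K 1 s.simplex.1.2).trans
        (congrArg (fun a => SSet.opObjEquiv a.1.2) s.d₁)
  · rintro ⟨⟨s⟩, ⟨t⟩⟩
    have d₀ : (K ⊗ K.op).δ 0 (s.simplex, SSet.opObjEquiv.symm t.simplex) = g.edge.1 :=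
      Prod.ext s.d₀ (SSet.opObjEquiv.injective
        ((SSet.δ_opObjEquiv K 2 (SSet.opObjEquiv.symm t.simplex)).symm.trans t.d₂))
    have d₁ : (K ⊗ K.op).δ 1 (s.simplex, SSet.opObjEquiv.symm t.simplex) = h.edge.1 :=
      Prod.ext s.d₁ (SSet.opObjEquiv.injective
        ((SSet.δ_opObjEquiv K 1 (SSet.opObjEquiv.symm t.simplex)).symm.trans t.d₁))
    have d₂ : (K ⊗ K.op).δ 2 (s.simplex, SSet.opObjEquiv.symm t.simplex) = f.edge.1 :=
      Prod.ext s.d₂ (SSet.opObjEquiv.injective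
        ((SSet.δ_opObjEquiv K 0 (SSet.opObjEquiv.symm t.simplex)).symm.trans t.d₀))
    refine ⟨.mk ⟨(s.simplex, SSet.opObjEquiv.symm t.simplex),
      mem_hprjSubcomplex_of_faces _ fun k => ?_⟩
      (Subtype.ext d₂) (Subtype.ext d₀) (Subtype.ext d₁)⟩
    fin_cases k
    exacts [d₀ ▸ g.edge.2, d₁ ▸ h.edge.2, d₂ ▸ f.edge.2]

lemma homotopic_iff_plus_minus {X Y : HPrj K _⦋0⦌} {f g : SSet.Edge X Y} :
    Homotopic f g ↔ hoMap (plus f) = hoMap (plus g) ∧ hoMap (minus f) = hoMap (minus g) := by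
  refine isComp_iff_plus_minus.trans ?_
  simp [isComp_iff]

end HPrj

end ZeroInfty

end HDom

/-! ### The theorem -/

theorem theorem2p2 (K : SSet.{u}) [HDom.ZeroInftyCategory K]
    (D : HDom.OmegaDiagram (HDom.HPrj K)) (L : K _⦋0⦌)
    (γ : ∀ i, SSet.Edge L (HDom.HPrj.base (D.obj i)))
    (hγ : D.projections.IsLimit L γ) :
    (∀ i, ∃ δ : SSet.Edge (HDom.HPrj.base (D.obj i)) L, HDom.IsHProjectionPair δ (γ i)) ∧
    ∀ (δ : ∀ i, SSet.Edge (HDom.HPrj.base (D.obj i)) L)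
      (hδ : ∀ i, HDom.IsHProjectionPair (δ i) (γ i)),
      D.IsColimit (HDom.HPrj.vertex L)
        (fun i => HDom.HPrj.edge (Y := HDom.HPrj.vertex L) (δ i) (γ i) (hδ i)) := by
  have hL := hγ.isSequentialLimit
  have hpair {X Y : HDom.HPrj K _⦋0⦌} (f : SSet.Edge X Y) :=
    HDom.isHProjectionPair_iff.1 (HDom.HPrj.isHProjectionPair f)
  have hep := fun i => hpair (D.map i)
  refine ⟨fun i => ?_, fun δ hδ => ?_⟩
  · obtain ⟨d, hd⟩ := hL.exists_isProjectionPair hep i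
    obtain ⟨δ, rfl⟩ := HDom.hoMap_surjective d
    exact ⟨δ, HDom.isHProjectionPair_iff.2 hd⟩
  have hδ' := fun i => HDom.isHProjectionPair_iff.1 (hδ i)
  refine ⟨fun i => ?_, fun T τ hτ => ?_, fun T τ hτ h h' hh hh' => ?_⟩
  · exact HDom.HPrj.isComp_iff_plus_minus.2 ⟨HDom.isComp_iff.2 (hL.embedding_cocone hep hδ' i),
      HDom.isComp_iff.2 (hL.cone i)⟩
  · have hτ' := fun i => HDom.HPrj.isComp_iff_plus_minus.1 (hτ i)
    obtain ⟨f, g, hfg, hf, hg⟩ := hL.exists_isProjectionPair_desc hep hδ' (fun i => hpair (τ i))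
      (fun i => HDom.isComp_iff.1 (hτ' i).1) (fun i => HDom.isComp_iff.1 (hτ' i).2)
    obtain ⟨f, rfl⟩ := HDom.hoMap_surjective f
    obtain ⟨g, rfl⟩ := HDom.hoMap_surjective g
    exact ⟨HDom.HPrj.edge (X := HDom.HPrj.vertex L) f g (HDom.isHProjectionPair_iff.2 hfg),
      fun i => HDom.HPrj.isComp_iff_plus_minus.2
        ⟨HDom.isComp_iff.2 (hf i), HDom.isComp_iff.2 (hg i)⟩⟩
  · have hminus : HDom.hoMap (HDom.HPrj.minus h) = HDom.hoMap (HDom.HPrj.minus h') :=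
      hL.hom_ext fun i =>
        (HDom.isComp_iff.1 (HDom.HPrj.isComp_iff_plus_minus.1 (hh i)).2).trans
          (HDom.isComp_iff.1 (HDom.HPrj.isComp_iff_plus_minus.1 (hh' i)).2).symm
    exact HDom.HPrj.homotopic_iff_plus_minus.2
      ⟨(hpair h).embedding_unique (hminus ▸ hpair h'), hminus⟩
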